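/- A hypergraph consists of vertices and edges, each edge being a set of vertices (multiple edges are allowed). It is $d$-regular if every vertex lies in exactly $d$ edges, and connected if any two vertices are joined by a walk. Its adjacency matrix (or operator) $A$ has entries $a_{uv}=|\{e:\{u,v\}\subseteq e\}|$ for $u\neq v$ and $a_{uu}=0$. For a finite hypergraph $H$ with $n\ge 2$ vertices let $\lambda_1(H)\ge\lambda_2(H)\ge\cdots\ge\lambda_n(H)$ be the eigenvalues of $A(H)$ with multiplicity. For a hypergraph $T$, possibly infinite, with bounded vertex degrees and edge sizes, let $\rho(T)$ be the spectral radius of $A(T)$ as a bounded operator on $\ell^2(V(T))$. For a finite connected hypergraph $H$, let $B_H$ be its incidence graph (the bipartite graph on vertices and edges of $H$, with $v$ adjacent to $e$ when $v\in e$). The universal cover $\mathbb T_{B_H}$ is the tree whose vertices are the non-backtracking walks of $B_H$ starting at a fixed vertex $v_0$ of $H$, two of them being adjacent if their lengths differ by $1$ and one is a prefix of the other. The universal cover $\mathbb T_H$ of $H$ is the hypergraph whose vertices are the walks ending at a vertex of $H$, and whose edges correspond to the walks ending at an edge of $H$, each such walk giving the set of its neighbours in $\mathbb T_{B_H}$.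 **Theorem.** Let $d$ be a nonnegative integer and $T$ a hypergraph. Then there is a function $\varepsilon:\mathbb N\to\mathbb R$ with $\varepsilon(n)\to 0$ as $n\to\infty$ such that every finite connected $d$-regular hypergraph $H$ with $n\ge 2$ vertices whose universal cover $\mathbb T_H$ is isomorphic to $T$ satisfies $$\lambda_2(H)\ \ge\ \rho(\mathbb T_H)-\varepsilon(n).$$ In other words, $\lambda_2(H)\ge\rho(\mathbb T_H)-o_n(1)$ for the finite connected $d$-regular hypergraphs $H$ with a given universal cover, where $n=|V(H)|$. -/

import Mathlib

/-- A hypergraph with vertex type `V` and edges labelled by `E`; each edge is a set of vertices.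
Different labels may carry the same set, so multiple edges are allowed. -/
structure MultiHypergraph (V : Type*) (E : Type*) where
  /-- the set of vertices of an edge -/
  verts : E → Set V

namespace MultiHypergraph

variable {V E V' E' : Type*}

/-- The set of edges containing the vertex `v`. -/
def edgesAt (H : MultiHypergraph V E) (v : V) : Set E := {e | v ∈ H.verts e}

/-- Every vertex lies in exactly `d` edges. -/
def IsRegular (H : MultiHypergraph V E) (d : ℕ) : Prop :=
  ∀ v, (H.edgesAt v).Finite ∧ (H.edgesAt v).ncard = d

/-- Any two vertices are joined by a walk `v₀ e₁ v₁ ⋯ e_l v_l`, where `v_i ≠ v_{i+1}` and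
`{v_i, v_{i+1}} ⊆ e_{i+1}`. -/
def IsConnected (H : MultiHypergraph V E) : Prop :=
  ∀ u v, Relation.ReflTransGen (fun a b ↦ a ≠ b ∧ ∃ e, a ∈ H.verts e ∧ b ∈ H.verts e) u v

/-- An isomorphism of hypergraphs: bijections on vertices and on edges that respect incidence. -/
structure Iso (H : MultiHypergraph V E) (H' : MultiHypergraph V' E') where
  /-- the bijection on vertices -/
  onVerts : V ≃ V'
  /-- the bijection on edges -/
  onEdges : E ≃ E'
  mem_iff : ∀ v e, onVerts v ∈ H'.verts (onEdges e) ↔ v ∈ H.verts e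

/-- The incidence graph: bipartite on `V ⊕ E`, with `v` adjacent to `e` when `v ∈ e`. -/
def incidenceGraph (H : MultiHypergraph V E) : SimpleGraph (V ⊕ E) where
  Adj a b := match a, b with
    | .inl v, .inr e => v ∈ H.verts e
    | .inr e, .inl v => v ∈ H.verts e
    | _, _ => False
  symm := ⟨by rintro (a | a) (b | b) h <;> exact h⟩
  loopless := ⟨by rintro (a | a) h <;> exact h⟩

/-- The entry `a_{uv}` of the adjacency matrix: for `u ≠ v` the number of edges containing both
`u` and `v`, and `0` for `u = v`. -/
noncomputable def adjCount (H : MultiHypergraph V E) (u v : V) : ℕ :=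
  open Classical in if u = v then 0 else {e | u ∈ H.verts e ∧ v ∈ H.verts e}.ncard

theorem adjCount_comm (H : MultiHypergraph V E) (u v : V) : H.adjCount u v = H.adjCount v u := by
  have h : {e | u ∈ H.verts e ∧ v ∈ H.verts e} = {e | v ∈ H.verts e ∧ u ∈ H.verts e} :=
    Set.ext fun _ ↦ and_comm
  by_cases huv : u = v
  · rw [huv]
  · rw [adjCount, adjCount, if_neg huv, if_neg (Ne.symm huv), h]

/-! ### The second largest eigenvalue of a finite hypergraph -/

/-- The adjacency matrix. -/
noncomputable def adjMatrix (H : MultiHypergraph V E) : Matrix V V ℝ :=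
  Matrix.of fun u v ↦ (H.adjCount u v : ℝ)

theorem adjMatrix_isHermitian (H : MultiHypergraph V E) : H.adjMatrix.IsHermitian := by
  ext u v
  simp [adjMatrix, H.adjCount_comm u v]

/-- The second largest eigenvalue `λ₂` of the adjacency matrix, eigenvalues being listed in
decreasing order with multiplicity (`eigenvalues₀` is indexed from `0`). -/
noncomputable def secondEigenvalue [Fintype V] (H : MultiHypergraph V E)
    (h : 2 ≤ Fintype.card V) : ℝ :=
  open Classical in H.adjMatrix_isHermitian.eigenvalues₀ ⟨1, h⟩

/-! ### The adjacency operator and the spectral radius of a hypergraph of bounded degrees -/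

/-- Degrees of vertices and sizes of edges are finite and bounded. -/
class BoundedDegree (H : MultiHypergraph V E) : Prop where
  exists_bound : ∃ C : ℕ, (∀ v, (H.edgesAt v).Finite ∧ (H.edgesAt v).ncard ≤ C) ∧
    ∀ e, (H.verts e).Finite ∧ (H.verts e).ncard ≤ C

/-- The vertices joined to `u`, i.e. the support of a row of the adjacency matrix, are finitely
many. -/
theorem finite_adjCount_support (H : MultiHypergraph V E) [H.BoundedDegree] (u : V) :
    {v | H.adjCount u v ≠ 0}.Finite := by
  obtain ⟨C, hv, he⟩ := BoundedDegree.exists_bound (H := H)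
  refine ((hv u).1.biUnion (fun e _ ↦ (he e).1)).subset ?_
  intro v h
  simp only [Set.mem_ofPred_eq, adjCount] at h
  split_ifs at h
  · simp at h
  · obtain ⟨e, h1, h2⟩ := Set.nonempty_of_ncard_ne_zero h
    exact Set.mem_biUnion (x := e) h1 h2

/-- The row sums of the adjacency matrix are bounded. -/
theorem exists_row_bound (H : MultiHypergraph V E) [H.BoundedDegree] :
    ∃ K : ℕ, ∀ u, ∀ s : Finset V, ∑ v ∈ s, H.adjCount u v ≤ K := by
  classical
  obtain ⟨C, hv, he⟩ := BoundedDegree.exists_bound (H := H)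
  refine ⟨C * C, fun u s ↦ ?_⟩
  have key : ∀ v, H.adjCount u v ≤ ∑ e ∈ (hv u).1.toFinset, if v ∈ H.verts e then 1 else 0 := by
    intro v
    rw [Finset.sum_boole]
    unfold adjCount
    split_ifs
    · simp
    · rw [← Set.ncard_coe_finset]
      simp only [Nat.cast_id]
      apply le_of_eq
      congr 1
      ext e
      simp [edgesAt]
  calc ∑ v ∈ s, H.adjCount u v
      ≤ ∑ v ∈ s, ∑ e ∈ (hv u).1.toFinset, (if v ∈ H.verts e then 1 else 0) :=
        Finset.sum_le_sum fun v _ ↦ key v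
    _ = ∑ e ∈ (hv u).1.toFinset, ∑ v ∈ s, (if v ∈ H.verts e then 1 else 0) := Finset.sum_comm
    _ ≤ ∑ e ∈ (hv u).1.toFinset, C := by
        refine Finset.sum_le_sum fun e _ ↦ ?_
        rw [Finset.sum_boole, Nat.cast_id, ← Set.ncard_coe_finset]
        refine le_trans (Set.ncard_le_ncard ?_ (he e).1) (he e).2
        intro v hv
        simp only [Finset.coe_filter, Set.mem_ofPred_eq] at hv
        exact hv.2
    _ ≤ C * C := by
        rw [Finset.sum_const, smul_eq_mul, ← Set.ncard_eq_toFinset_card _ (hv u).1]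
        exact Nat.mul_le_mul_right _ (hv u).2

/-- The function `A x`, where `(A x)_u = ∑_v a_{uv} x_v` (a sum with finitely many nonzero
terms). -/
noncomputable def adjFun (H : MultiHypergraph V E) (x : V → ℂ) (u : V) : ℂ :=
  ∑ᶠ v, (H.adjCount u v : ℂ) * x v

theorem adjFun_eq_sum (H : MultiHypergraph V E) [H.BoundedDegree] (x : V → ℂ) (u : V)
    {s : Finset V} (hs : (H.finite_adjCount_support u).toFinset ⊆ s) :
    H.adjFun x u = ∑ v ∈ s, (H.adjCount u v : ℂ) * x v := by
  refine finsum_eq_sum_of_support_subset _ fun v hv ↦ hs ?_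
  simp only [Function.mem_support] at hv
  simp only [Set.Finite.mem_toFinset, Set.mem_ofPred_eq]
  intro h
  simp [h] at hv

/-- The Schur bound on finite sets of coordinates. -/
theorem sum_norm_adjFun_sq_le (H : MultiHypergraph V E) [H.BoundedDegree] {K : ℕ}
    (hK : ∀ u, ∀ s : Finset V, ∑ v ∈ s, H.adjCount u v ≤ K) (x : lp (fun _ : V ↦ ℂ) 2)
    (S : Finset V) : ∑ u ∈ S, ‖H.adjFun x u‖ ^ 2 ≤ ((K : ℝ) * ‖x‖) ^ 2 := by
  classical
  set W : Finset V := S.biUnion fun u ↦ (H.finite_adjCount_support u).toFinset with hW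
  have hKr : ∀ u, ∀ s : Finset V, ∑ v ∈ s, (H.adjCount u v : ℝ) ≤ K := fun u s ↦ by
    exact_mod_cast hK u s
  have h1 : ∀ u ∈ S, ‖H.adjFun x u‖ ^ 2 ≤ K * ∑ v ∈ W, (H.adjCount u v : ℝ) * ‖x v‖ ^ 2 := by
    intro u hu
    have hn : ‖H.adjFun x u‖ ≤ ∑ v ∈ W, (H.adjCount u v : ℝ) * ‖x v‖ := by
      rw [H.adjFun_eq_sum x u (s := W) (Finset.subset_biUnion_of_mem
        (fun u ↦ (H.finite_adjCount_support u).toFinset) hu)]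
      refine (norm_sum_le _ _).trans (le_of_eq ?_)
      simp
    calc ‖H.adjFun x u‖ ^ 2 ≤ (∑ v ∈ W, (H.adjCount u v : ℝ) * ‖x v‖) ^ 2 := by gcongr
      _ ≤ (∑ v ∈ W, (H.adjCount u v : ℝ)) * ∑ v ∈ W, (H.adjCount u v : ℝ) * ‖x v‖ ^ 2 := by
          refine Finset.sum_sq_le_sum_mul_sum_of_sq_le_mul W (fun v _ ↦ by positivity)
            (fun v _ ↦ by positivity) (fun v _ ↦ le_of_eq (by ring))
      _ ≤ _ := by
          gcongr
          exact hKr u W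
  have h2 : ∑ v ∈ W, ‖x v‖ ^ 2 ≤ ‖x‖ ^ 2 := by
    have := lp.sum_rpow_le_norm_rpow (p := 2) (by norm_num) x W
    simpa using this
  calc ∑ u ∈ S, ‖H.adjFun x u‖ ^ 2
      ≤ ∑ u ∈ S, K * ∑ v ∈ W, (H.adjCount u v : ℝ) * ‖x v‖ ^ 2 := Finset.sum_le_sum h1
    _ = K * ∑ v ∈ W, (∑ u ∈ S, (H.adjCount v u : ℝ)) * ‖x v‖ ^ 2 := by
        rw [← Finset.mul_sum, Finset.sum_comm]
        simp only [Finset.sum_mul, H.adjCount_comm]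
    _ ≤ K * ∑ v ∈ W, (K : ℝ) * ‖x v‖ ^ 2 := by
        gcongr with v hv
        exact hKr v S
    _ = K * K * ∑ v ∈ W, ‖x v‖ ^ 2 := by rw [← Finset.mul_sum]; ring
    _ ≤ K * K * ‖x‖ ^ 2 := by gcongr
    _ = _ := by ring

theorem memℓp_adjFun (H : MultiHypergraph V E) [H.BoundedDegree] (x : lp (fun _ : V ↦ ℂ) 2) :
    Memℓp (E := fun _ : V ↦ ℂ) (H.adjFun x) 2 := by
  obtain ⟨K, hK⟩ := H.exists_row_bound
  refine memℓp_gen' (C := ((K : ℝ) * ‖x‖) ^ 2) fun S ↦ ?_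
  simpa using H.sum_norm_adjFun_sq_le hK x S

theorem adjFun_add (H : MultiHypergraph V E) [H.BoundedDegree] (x y : V → ℂ) :
    H.adjFun (x + y) = H.adjFun x + H.adjFun y := by
  ext u
  simp only [Pi.add_apply, H.adjFun_eq_sum _ u subset_rfl, mul_add, Finset.sum_add_distrib]

theorem adjFun_smul (H : MultiHypergraph V E) [H.BoundedDegree] (c : ℂ) (x : V → ℂ) :
    H.adjFun (c • x) = c • H.adjFun x := by
  ext u
  simp only [Pi.smul_apply, H.adjFun_eq_sum _ u subset_rfl, smul_eq_mul, Finset.mul_sum]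
  exact Finset.sum_congr rfl fun v _ ↦ by ring

/-- The adjacency operator as a linear map of `ℓ²(V)`. -/
noncomputable def adjLinearMap (H : MultiHypergraph V E) [H.BoundedDegree] :
    lp (fun _ : V ↦ ℂ) 2 →ₗ[ℂ] lp (fun _ : V ↦ ℂ) 2 where
  toFun x := ⟨H.adjFun x, H.memℓp_adjFun x⟩
  map_add' x y := Subtype.ext (H.adjFun_add x y)
  map_smul' c x := Subtype.ext (H.adjFun_smul c x)

theorem exists_adjLinearMap_bound (H : MultiHypergraph V E) [H.BoundedDegree] :
    ∃ C : ℝ, ∀ x, ‖H.adjLinearMap x‖ ≤ C * ‖x‖ := by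
  obtain ⟨K, hK⟩ := H.exists_row_bound
  refine ⟨K, fun x ↦ lp.norm_le_of_forall_sum_le (p := 2) (by norm_num) (by positivity)
    fun S ↦ ?_⟩
  simpa using! H.sum_norm_adjFun_sq_le hK x S

/-- The adjacency operator `A`, a bounded linear operator on the complex Hilbert space `ℓ²(V)`. -/
noncomputable def adjOperator (H : MultiHypergraph V E) [H.BoundedDegree] :
    lp (fun _ : V ↦ ℂ) 2 →L[ℂ] lp (fun _ : V ↦ ℂ) 2 :=
  H.adjLinearMap.mkContinuousOfExistsBound H.exists_adjLinearMap_bound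

theorem adjOperator_apply (H : MultiHypergraph V E) [H.BoundedDegree]
    (x : lp (fun _ : V ↦ ℂ) 2) (u : V) :
    H.adjOperator x u = ∑ᶠ v, (H.adjCount u v : ℂ) * x v := rfl

/-- The spectral radius `ρ` of the adjacency operator. -/
noncomputable def rho (H : MultiHypergraph V E) [H.BoundedDegree] : ℝ :=
  (spectralRadius ℂ H.adjOperator).toReal

end MultiHypergraph

/-! ### Universal covers -/

/-- The non-backtracking walks in `G` that start at `v₀`: no step is the reverse of the one
before. -/
abbrev NonBacktrackingWalk {X : Type*} (G : SimpleGraph X) (v₀ : X) : Type _ :=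
  (w : X) × {p : G.Walk v₀ w // p.darts.IsChain fun a b ↦ b ≠ a.symm}

namespace NonBacktrackingWalk

variable {X : Type*} {G : SimpleGraph X} {v₀ : X}

/-- The last vertex of the walk. -/
def endpoint (p : NonBacktrackingWalk G v₀) : X := p.1

/-- `p` is the prefix of `q` that is one step shorter. -/
def IsParent (p q : NonBacktrackingWalk G v₀) : Prop :=
  q.2.1.length = p.2.1.length + 1 ∧ p.2.1.support <+: q.2.1.support

theorem ext_support {p q : NonBacktrackingWalk G v₀} (h : p.2.1.support = q.2.1.support) :
    p = q := by
  obtain ⟨w, p, hp⟩ := p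
  obtain ⟨w', q, hq⟩ := q
  simp only at h
  have hw : w = w' := by
    rw [← p.getLast_support, ← q.getLast_support]
    simp only [h]
  subst hw
  obtain rfl := SimpleGraph.Walk.ext_support h
  rfl

theorem IsParent.support_eq {p q : NonBacktrackingWalk G v₀} (h : p.IsParent q) :
    q.2.1.support = p.2.1.support ++ [q.endpoint] := by
  obtain ⟨hl, t, ht⟩ := h
  have h1 := congrArg List.length ht
  simp only [List.length_append, SimpleGraph.Walk.length_support] at h1
  obtain ⟨a, rfl⟩ := List.length_eq_one_iff.1 (show t.length = 1 by omega)
  have h2 : q.2.1.support.getLast (by simp) = q.endpoint := q.2.1.getLast_support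
  simp only [← ht, List.getLast_append_singleton] at h2
  rw [← ht, h2]

theorem IsParent.left_unique {p p' q : NonBacktrackingWalk G v₀} (h : p.IsParent q)
    (h' : p'.IsParent q) : p = p' := by
  have := h.support_eq.symm.trans h'.support_eq
  exact ext_support (List.append_cancel_right this)

theorem IsParent.right_unique {p q q' : NonBacktrackingWalk G v₀} (h : p.IsParent q)
    (h' : p.IsParent q') (he : q.endpoint = q'.endpoint) : q = q' :=
  ext_support (by rw [h.support_eq, h'.support_eq, he])

end NonBacktrackingWalk

/-- The universal cover of a connected graph `G` with root `v₀`: its vertices are the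
non-backtracking walks of `G` that start at `v₀`, and two of them are adjacent if their lengths
differ by `1` and one is a prefix of the other. -/
def SimpleGraph.universalCover {X : Type*} (G : SimpleGraph X) (v₀ : X) :
    SimpleGraph (NonBacktrackingWalk G v₀) where
  Adj p q := p.IsParent q ∨ q.IsParent p
  symm := ⟨fun _ _ h ↦ h.symm⟩
  loopless := ⟨fun p h ↦ by rcases h with h | h <;> exact absurd h.1 (by omega)⟩

/-- In the universal cover of a finite graph the degrees are bounded. -/
theorem SimpleGraph.universalCover_neighbors {X : Type*} [Finite X] (G : SimpleGraph X) (v₀ : X)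
    (p : NonBacktrackingWalk G v₀) :
    {q | (G.universalCover v₀).Adj p q}.Finite ∧
      {q | (G.universalCover v₀).Adj p q}.ncard ≤ Nat.card X + 1 := by
  classical
  let f : NonBacktrackingWalk G v₀ → Option X :=
    fun q ↦ if p.IsParent q then some q.endpoint else none
  have hf : Set.InjOn f {q | (G.universalCover v₀).Adj p q} := by
    intro q hq q' hq' h
    simp only [f] at h
    split_ifs at h with h1 h2 h2
    · exact h1.right_unique h2 (Option.some.inj h)
    · exact (hq.resolve_left h1).left_unique (hq'.resolve_left h2)
  refine ⟨Set.Finite.of_injOn (Set.mapsTo_univ f _) hf Set.finite_univ, ?_⟩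
  have := Set.ncard_le_ncard_of_injOn f (t := Set.univ) (fun _ _ ↦ Set.mem_univ _) hf
    Set.finite_univ
  rwa [Set.ncard_univ, Finite.card_option] at this

namespace MultiHypergraph

variable {V E : Type*}

/-- The universal cover `𝕋_H` of a connected hypergraph `H` with root the vertex `v₀`. Let `𝕋` be
the universal cover of the incidence graph of `H`. The vertices of `𝕋_H` are the vertices of `𝕋`
that end at a vertex of `H`, its edges are labelled by the vertices of `𝕋` that end at an edge of
`H`, and the edge labelled `e` consists of the vertices adjacent to `e` in `𝕋`. -/
def universalCover (H : MultiHypergraph V E) (v₀ : V) :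
    MultiHypergraph
      {p : NonBacktrackingWalk H.incidenceGraph (.inl v₀) // p.endpoint.isLeft = true}
      {p : NonBacktrackingWalk H.incidenceGraph (.inl v₀) // p.endpoint.isRight = true} where
  verts e := {w | (H.incidenceGraph.universalCover (.inl v₀)).Adj w.1 e.1}

instance universalCover_boundedDegree [Finite V] [Finite E] (H : MultiHypergraph V E) (v₀ : V) :
    (H.universalCover v₀).BoundedDegree := by
  refine ⟨Nat.card (V ⊕ E) + 1, fun w ↦ ?_, fun e ↦ ?_⟩
  · obtain ⟨h1, h2⟩ := H.incidenceGraph.universalCover_neighbors (.inl v₀) w.1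
    refine ⟨Set.Finite.of_injOn (f := Subtype.val) (fun e he ↦ he)
      Subtype.val_injective.injOn h1, le_trans ?_ h2⟩
    exact Set.ncard_le_ncard_of_injOn Subtype.val (fun e he ↦ he)
      Subtype.val_injective.injOn h1
  · obtain ⟨h1, h2⟩ := H.incidenceGraph.universalCover_neighbors (.inl v₀) e.1
    refine ⟨Set.Finite.of_injOn (f := Subtype.val) (fun w hw ↦
      (H.incidenceGraph.universalCover (.inl v₀)).adj_symm hw)
      Subtype.val_injective.injOn h1, le_trans ?_ h2⟩
    exact Set.ncard_le_ncard_of_injOn Subtype.val (fun w hw ↦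
      (H.incidenceGraph.universalCover (.inl v₀)).adj_symm hw)
      Subtype.val_injective.injOn h1

end MultiHypergraph

universe u v w z

/-! The spectral radius of the universal cover is at most the supremum of the Rayleigh quotients of
its nonnegative finitely supported functions (`RayleighLE.rho_le`). So it suffices to bring one
finitely supported function `f` with nearly optimal quotient down to `H`, twice, with supports far
apart.

The function descends along the covering map even where that map is not injective on the support of
`f`: replace `f` by its `ℓ²` norms on the fibres. This keeps the norm, and since the map is
injective around each vertex and on each edge, the Schur test shows that the quadratic form does not
decrease (`IsImmersion.exists_pushforward`). Thus no girth assumption is needed.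

Fix one reference hypergraph `H₀` with cover `T`, and choose `f` on its cover. As `T` covers the
finite `H₀`, every vertex of `T` is within bounded distance of a place where a copy of `f` can be
put. Hence a copy lands in a ball of fixed radius around any prescribed vertex of any `H` covered by
`T` (`exists_transport`). Degrees in `H` are bounded in terms of `H₀`, so a large `H` has two
distant vertices. The two copies there span a plane on which all Rayleigh quotients are large, and
the min-max principle bounds `λ₂` from below (`exists_forall_le_secondEigenvalue`). -/

namespace MultiHypergraph

/-! ### Rayleigh quotients and the spectral radius -/

variable {V E V' E' : Type*}

/-- All Rayleigh quotients of nonnegative finitely supported functions are at most `m`. -/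
def RayleighLE (H : MultiHypergraph V E) (m : ℝ) : Prop :=
  ∀ (S : Finset V) (f : V → ℝ), (∀ v, 0 ≤ f v) →
    ∑ u ∈ S, ∑ v ∈ S, (H.adjCount u v : ℝ) * (f u * f v) ≤ m * ∑ v ∈ S, f v ^ 2

theorem adjCount_self (H : MultiHypergraph V E) (u : V) : H.adjCount u u = 0 := by
  simp [adjCount]

theorem adjCount_of_ne (H : MultiHypergraph V E) {u v : V} (h : u ≠ v) :
    H.adjCount u v = {e | u ∈ H.verts e ∧ v ∈ H.verts e}.ncard := by
  rw [adjCount, if_neg h]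

theorem RayleighLE.mono {H : MultiHypergraph V E} {m m' : ℝ} (h : H.RayleighLE m)
    (hm : m ≤ m') : H.RayleighLE m' := fun S f hf ↦
  (h S f hf).trans (by gcongr)

theorem RayleighLE.nonneg [Nonempty V] {H : MultiHypergraph V E} {m : ℝ}
    (h : H.RayleighLE m) : 0 ≤ m := by
  obtain ⟨v⟩ := ‹Nonempty V›
  simpa [adjCount_self] using h {v} (fun _ ↦ 1) (fun _ ↦ zero_le_one)

/-- Polarization. The hypothesis covers nonnegative functions only, so it is applied to `x + y` and
to `|x - y|`. Passing to absolute values is harmless because the entries of `A` are nonnegative, and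
the parallelogram law adds up the norms. -/
theorem RayleighLE.two_mul_sum_le {H : MultiHypergraph V E} {m : ℝ} (h : H.RayleighLE m)
    (S : Finset V) {x y : V → ℝ} (hx : ∀ v, 0 ≤ x v) (hy : ∀ v, 0 ≤ y v) :
    2 * ∑ u ∈ S, ∑ v ∈ S, (H.adjCount u v : ℝ) * (x u * y v) ≤
      m * (∑ v ∈ S, x v ^ 2 + ∑ v ∈ S, y v ^ 2) := by
  have h1 := h S (fun v ↦ x v + y v) (fun v ↦ add_nonneg (hx v) (hy v))
  have h2 := h S (fun v ↦ |x v - y v|) (fun v ↦ abs_nonneg _)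
  have hsymm : ∑ u ∈ S, ∑ v ∈ S, (H.adjCount u v : ℝ) * (y u * x v) =
      ∑ u ∈ S, ∑ v ∈ S, (H.adjCount u v : ℝ) * (x u * y v) := by
    rw [Finset.sum_comm]
    refine Finset.sum_congr rfl fun u _ ↦ Finset.sum_congr rfl fun v _ ↦ ?_
    rw [H.adjCount_comm v u, mul_comm (y v)]
  have h3 : 2 * ∑ u ∈ S, ∑ v ∈ S, (H.adjCount u v : ℝ) * (x u * y v) +
      2 * ∑ u ∈ S, ∑ v ∈ S, (H.adjCount u v : ℝ) * (y u * x v) ≤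
      ∑ u ∈ S, ∑ v ∈ S, (H.adjCount u v : ℝ) * ((x u + y u) * (x v + y v)) +
      ∑ u ∈ S, ∑ v ∈ S, (H.adjCount u v : ℝ) * (|x u - y u| * |x v - y v|) := by
    simp only [Finset.mul_sum, ← Finset.sum_add_distrib]
    refine Finset.sum_le_sum fun u _ ↦ Finset.sum_le_sum fun v _ ↦ ?_
    have h4 : -((x u - y u) * (x v - y v)) ≤ |x u - y u| * |x v - y v| := by
      rw [← abs_mul]
      exact neg_le_abs _
    have h5 : (0 : ℝ) ≤ H.adjCount u v := by positivity
    nlinarith [mul_le_mul_of_nonneg_left h4 h5]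
  have h6 : ∑ v ∈ S, (x v + y v) ^ 2 + ∑ v ∈ S, |x v - y v| ^ 2 =
      2 * (∑ v ∈ S, x v ^ 2 + ∑ v ∈ S, y v ^ 2) := by
    simp only [Finset.mul_sum, ← Finset.sum_add_distrib]
    refine Finset.sum_congr rfl fun u _ ↦ ?_
    rw [sq_abs]
    ring
  have h7 : m * ∑ v ∈ S, (x v + y v) ^ 2 + m * ∑ v ∈ S, |x v - y v| ^ 2 =
      2 * (m * (∑ v ∈ S, x v ^ 2 + ∑ v ∈ S, y v ^ 2)) := by
    rw [← mul_add, h6]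
    ring
  linarith

/-- Let `y` be `|A x|` on `S` and `N` its squared norm. Then `N ≤ ⟨y, A |x|⟩`, and the polarized
bound for `y` and `m |x|` gives `2 m N ≤ m (N + m² ‖x‖²)`. The set `W` contains `S` and all its
neighbours, so the sums over `W` lose nothing. -/
theorem RayleighLE.sum_norm_adjFun_sq_le {H : MultiHypergraph V E} [H.BoundedDegree] {m : ℝ}
    (h : H.RayleighLE m) (hm : 0 < m) (x : lp (fun _ : V ↦ ℂ) 2) (S : Finset V) :
    ∑ u ∈ S, ‖H.adjFun x u‖ ^ 2 ≤ (m * ‖x‖) ^ 2 := by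
  classical
  set W : Finset V := S ∪ S.biUnion fun u ↦ (H.finite_adjCount_support u).toFinset with hW
  have hSW : S ⊆ W := Finset.subset_union_left
  set N := ∑ u ∈ S, ‖H.adjFun x u‖ ^ 2 with hN
  set y : V → ℝ := fun u ↦ if u ∈ S then ‖H.adjFun x u‖ else 0 with hy
  have hy0 : ∀ u, 0 ≤ y u := fun u ↦ by simp only [hy]; split_ifs <;> positivity
  have hNy : ∑ v ∈ W, y v ^ 2 = N := by
    rw [hN, ← Finset.sum_subset hSW]
    · exact Finset.sum_congr rfl fun u hu ↦ by simp [hy, hu]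
    · intro u _ hu
      simp [hy, hu]
  have hX : ∑ v ∈ W, ‖x v‖ ^ 2 ≤ ‖x‖ ^ 2 := by
    have := lp.sum_rpow_le_norm_rpow (p := 2) (by norm_num) x W
    simpa using this
  have hB : N ≤ ∑ u ∈ W, ∑ v ∈ W, (H.adjCount u v : ℝ) * (y u * ‖x v‖) := by
    calc N ≤ ∑ u ∈ S, ∑ v ∈ W, (H.adjCount u v : ℝ) * (y u * ‖x v‖) := by
          refine Finset.sum_le_sum fun u hu ↦ ?_
          have hn : ‖H.adjFun x u‖ ≤ ∑ v ∈ W, (H.adjCount u v : ℝ) * ‖x v‖ := by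
            rw [H.adjFun_eq_sum x u (s := W) ((Finset.subset_biUnion_of_mem
              (fun u ↦ (H.finite_adjCount_support u).toFinset) hu).trans
              Finset.subset_union_right)]
            refine (norm_sum_le _ _).trans (le_of_eq ?_)
            simp
          calc ‖H.adjFun x u‖ ^ 2 = y u * ‖H.adjFun x u‖ := by simp [hy, hu, sq]
            _ ≤ y u * ∑ v ∈ W, (H.adjCount u v : ℝ) * ‖x v‖ :=
              mul_le_mul_of_nonneg_left hn (hy0 u)
            _ = _ := by
              rw [Finset.mul_sum]
              exact Finset.sum_congr rfl fun v _ ↦ by ring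
      _ ≤ _ := Finset.sum_le_sum_of_subset_of_nonneg hSW fun u _ _ ↦
          Finset.sum_nonneg fun v _ ↦ mul_nonneg (by positivity)
            (mul_nonneg (hy0 u) (norm_nonneg _))
  have key := h.two_mul_sum_le W (x := y) (y := fun v ↦ m * ‖x v‖) hy0 (fun v ↦ by positivity)
  have h1 : ∑ u ∈ W, ∑ v ∈ W, (H.adjCount u v : ℝ) * (y u * (m * ‖x v‖)) =
      m * ∑ u ∈ W, ∑ v ∈ W, (H.adjCount u v : ℝ) * (y u * ‖x v‖) := by
    simp only [Finset.mul_sum]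
    exact Finset.sum_congr rfl fun u _ ↦ Finset.sum_congr rfl fun v _ ↦ by ring
  have h2 : ∑ v ∈ W, (m * ‖x v‖) ^ 2 = m ^ 2 * ∑ v ∈ W, ‖x v‖ ^ 2 := by
    simp only [Finset.mul_sum, mul_pow]
  rw [h1, h2, hNy] at key
  have h3 : m * (2 * N) ≤ m * (N + m ^ 2 * ‖x‖ ^ 2) := by
    have : m ^ 2 * ∑ v ∈ W, ‖x v‖ ^ 2 ≤ m ^ 2 * ‖x‖ ^ 2 := by gcongr
    have h4 := mul_le_mul_of_nonneg_left hB hm.le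
    have h5 := mul_le_mul_of_nonneg_left (add_le_add_right this N) hm.le
    linarith
  have h4 := le_of_mul_le_mul_left h3 hm
  rw [mul_pow]
  linarith

theorem RayleighLE.rho_le_of_pos {H : MultiHypergraph V E} [H.BoundedDegree] {m : ℝ}
    (h : H.RayleighLE m) (hm : 0 < m) : H.rho ≤ m := by
  have hnorm : ‖H.adjOperator‖ ≤ m := by
    refine ContinuousLinearMap.opNorm_le_bound _ hm.le fun x ↦ ?_
    refine lp.norm_le_of_forall_sum_le (p := 2) (by norm_num) (by positivity) fun S ↦ ?_
    simpa using! h.sum_norm_adjFun_sq_le hm x S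
  rw [rho]
  refine ENNReal.toReal_le_of_le_ofReal hm.le ?_
  have : spectralRadius ℂ H.adjOperator ≤ ‖H.adjOperator‖₊ := by
    cases subsingleton_or_nontrivial (lp (fun _ : V ↦ ℂ) 2)
    · rw [spectrum.SpectralRadius.of_subsingleton]
      exact zero_le
    · exact spectrum.spectralRadius_le_nnnorm _
  refine this.trans ?_
  rw [← ENNReal.ofReal_coe_nnreal]
  exact ENNReal.ofReal_le_ofReal hnorm

/-- The spectral radius is bounded by the Rayleigh quotients of nonnegative finitely supported
functions. -/
theorem RayleighLE.rho_le [Nonempty V] {H : MultiHypergraph V E} [H.BoundedDegree] {m : ℝ}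
    (h : H.RayleighLE m) : H.rho ≤ m :=
  le_of_forall_pos_le_add fun δ hδ ↦
    (h.mono (by linarith)).rho_le_of_pos (add_pos_of_nonneg_of_pos h.nonneg hδ)

/-- Any bound for the row sums works, by `f u * f v ≤ (f u ^ 2 + f v ^ 2) / 2` and symmetry. This
makes the infimum of the admissible `m` meaningful. -/
theorem exists_rayleighLE (H : MultiHypergraph V E) [H.BoundedDegree] :
    ∃ m : ℝ, H.RayleighLE m := by
  obtain ⟨K, hK⟩ := H.exists_row_bound
  have hKr : ∀ u, ∀ s : Finset V, ∑ v ∈ s, (H.adjCount u v : ℝ) ≤ K := fun u s ↦ by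
    exact_mod_cast hK u s
  refine ⟨K, fun S f hf ↦ ?_⟩
  have h1 : ∑ u ∈ S, ∑ v ∈ S, (H.adjCount u v : ℝ) * (f u * f v) ≤
      ∑ u ∈ S, ∑ v ∈ S, (H.adjCount u v : ℝ) * (f u ^ 2 / 2) +
      ∑ u ∈ S, ∑ v ∈ S, (H.adjCount u v : ℝ) * (f v ^ 2 / 2) := by
    simp only [← Finset.sum_add_distrib, ← mul_add]
    refine Finset.sum_le_sum fun u _ ↦ Finset.sum_le_sum fun v _ ↦ ?_
    gcongr
    nlinarith [sq_nonneg (f u - f v)]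
  have h2 : ∑ u ∈ S, ∑ v ∈ S, (H.adjCount u v : ℝ) * (f v ^ 2 / 2) =
      ∑ u ∈ S, ∑ v ∈ S, (H.adjCount u v : ℝ) * (f u ^ 2 / 2) := by
    rw [Finset.sum_comm]
    simp only [H.adjCount_comm]
  have h3 : ∑ u ∈ S, ∑ v ∈ S, (H.adjCount u v : ℝ) * (f u ^ 2 / 2) ≤
      ∑ u ∈ S, K * (f u ^ 2 / 2) := by
    refine Finset.sum_le_sum fun u _ ↦ ?_
    rw [← Finset.sum_mul]
    gcongr
    exact hKr u S
  rw [← Finset.mul_sum, ← Finset.sum_div] at h3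
  linarith

/-- Isomorphisms of hypergraphs can be reversed. -/
def Iso.symm {H : MultiHypergraph V E} {H' : MultiHypergraph V' E'} (φ : H.Iso H') :
    H'.Iso H where
  onVerts := φ.onVerts.symm
  onEdges := φ.onEdges.symm
  mem_iff v e := by simpa using (φ.mem_iff (φ.onVerts.symm v) (φ.onEdges.symm e)).symm

theorem Iso.adjCount_eq {H : MultiHypergraph V E} {H' : MultiHypergraph V' E'} (φ : H.Iso H')
    (u v : V) : H'.adjCount (φ.onVerts u) (φ.onVerts v) = H.adjCount u v := by
  by_cases huv : u = v
  · rw [huv, adjCount_self, adjCount_self]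
  · rw [adjCount_of_ne _ huv, adjCount_of_ne _ (by simpa using huv),
      ← Set.ncard_image_of_injective _ φ.onEdges.injective]
    congr 1
    ext e
    obtain ⟨e, rfl⟩ := φ.onEdges.surjective e
    simp [φ.mem_iff]

theorem RayleighLE.of_iso {H : MultiHypergraph V E} {H' : MultiHypergraph V' E'} {m : ℝ}
    (h : H.RayleighLE m) (φ : H.Iso H') : H'.RayleighLE m := by
  intro S f hf
  have := h (S.map φ.onVerts.symm.toEmbedding) (f ∘ φ.onVerts) (fun v ↦ hf _)
  simpa [Finset.sum_map, ← φ.adjCount_eq] using this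

end MultiHypergraph

/-! ### Immersions, coverings and lifts of walks -/

/-- A homomorphism of graphs that is injective on the neighbours of each vertex. -/
structure SimpleGraph.IsImmersion {X Y : Type*} (G : SimpleGraph X) (G' : SimpleGraph Y)
    (φ : X → Y) : Prop where
  map_adj : ∀ ⦃a b⦄, G.Adj a b → G'.Adj (φ a) (φ b)
  inj : ∀ ⦃a b c⦄, G.Adj a b → G.Adj a c → φ b = φ c → b = c

/-- A covering map of graphs: a homomorphism that is bijective on the neighbours of each
vertex. -/
structure SimpleGraph.IsCovering {X Y : Type*} (G : SimpleGraph X) (G' : SimpleGraph Y)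
    (φ : X → Y) : Prop extends G.IsImmersion G' φ where
  surj : ∀ ⦃a y⦄, G'.Adj (φ a) y → ∃ b, G.Adj a b ∧ φ b = y

namespace SimpleGraph

variable {X Y Z : Type*} {G : SimpleGraph X} {G' : SimpleGraph Y} {G'' : SimpleGraph Z}

theorem IsImmersion.comp {φ : X → Y} {ψ : Y → Z} (hψ : G'.IsImmersion G'' ψ)
    (hφ : G.IsImmersion G' φ) : G.IsImmersion G'' (ψ ∘ φ) where
  map_adj _ _ h := hψ.map_adj (hφ.map_adj h)
  inj _ _ _ h h' e := hφ.inj h h' (hψ.inj (hφ.map_adj h) (hφ.map_adj h') e)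

theorem IsCovering.comp_iso {φ : Y → Z} (hφ : G'.IsCovering G'' φ) (j : G ≃g G') :
    G.IsCovering G'' (φ ∘ j) where
  map_adj _ _ h := hφ.map_adj (j.map_adj_iff.2 h)
  inj _ _ _ h h' e := j.injective (hφ.inj (j.map_adj_iff.2 h) (j.map_adj_iff.2 h') e)
  surj a y h := by
    obtain ⟨b, hb, rfl⟩ := hφ.surj h
    exact ⟨j.symm b, by rw [← j.map_adj_iff]; simpa using hb, by simp⟩

theorem IsImmersion.exists_walk_map {φ : X → Y} (hφ : G.IsImmersion G' φ) {a b : X}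
    (p : G.Walk a b) : ∃ q : G'.Walk (φ a) (φ b), q.length = p.length :=
  ⟨p.map ⟨φ, fun h ↦ hφ.map_adj h⟩, by simp⟩

theorem IsCovering.exists_adj {φ : X → Y} (hφ : G.IsCovering G' φ) {x : X} {y z : Y}
    (hx : φ x = y) (h : G'.Adj y z) : ∃ b, G.Adj x b ∧ φ b = z := by
  subst hx
  exact hφ.surj h

/-- The last vertex of the lift of a walk along a covering map. -/
noncomputable def IsCovering.liftEnd {φ : X → Y} (hφ : G.IsCovering G' φ) :
    ∀ {y y' : Y}, G'.Walk y y' → ∀ x : X, φ x = y → X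
  | _, _, .nil, x, _ => x
  | _, _, .cons h p, _, hx =>
    liftEnd hφ p (hφ.exists_adj hx h).choose (hφ.exists_adj hx h).choose_spec.2

theorem IsCovering.map_liftEnd {φ : X → Y} (hφ : G.IsCovering G' φ) {y y' : Y}
    (p : G'.Walk y y') : ∀ (x : X) (hx : φ x = y), φ (hφ.liftEnd p x hx) = y' := by
  induction p with
  | nil => exact fun x hx ↦ hx
  | cons h p ih => exact fun x hx ↦ ih _ _

theorem IsCovering.exists_walk_liftEnd {φ : X → Y} (hφ : G.IsCovering G' φ) {y y' : Y}
    (p : G'.Walk y y') : ∀ (x : X) (hx : φ x = y),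
      ∃ q : G.Walk x (hφ.liftEnd p x hx), q.length = p.length := by
  induction p with
  | nil => exact fun x hx ↦ ⟨.nil, rfl⟩
  | cons h p ih =>
    intro x hx
    obtain ⟨q, hq⟩ := ih _ (hφ.exists_adj hx h).choose_spec.2
    exact ⟨.cons (hφ.exists_adj hx h).choose_spec.1 q, congrArg (· + 1) hq⟩

theorem IsCovering.exists_lift {φ : X → Y} (hφ : G.IsCovering G' φ) {y y' : Y}
    (p : G'.Walk y y') (x : X) (hx : φ x = y) :
    ∃ x', φ x' = y' ∧ ∃ q : G.Walk x x', q.length = p.length :=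
  ⟨_, hφ.map_liftEnd p x hx, hφ.exists_walk_liftEnd p x hx⟩

/-- Lifts are built from the start of the walk, so the lift of an extended walk extends the lift by
one step. -/
theorem IsCovering.adj_liftEnd_concat {φ : X → Y} (hφ : G.IsCovering G' φ) {y y' z : Y}
    (p : G'.Walk y y') (h : G'.Adj y' z) : ∀ (x : X) (hx : φ x = y),
      G.Adj (hφ.liftEnd p x hx) (hφ.liftEnd (p.concat h) x hx) := by
  induction p with
  | nil => exact fun x hx ↦ (hφ.exists_adj hx h).choose_spec.1
  | cons h' p ih => exact fun x hx ↦ ih h _ _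

end SimpleGraph

/-! ### The universal cover as a covering -/

namespace NonBacktrackingWalk

variable {X Y : Type*} {G : SimpleGraph X} {G' : SimpleGraph Y} {v₀ : X}

theorem IsParent.exists_eq_concat {p q : NonBacktrackingWalk G v₀} (h : p.IsParent q) :
    ∃ ha : G.Adj p.1 q.1, q.2.1 = p.2.1.concat ha := by
  have hs := h.support_eq
  obtain ⟨w, p, hp⟩ := p
  obtain ⟨w', q, hq⟩ := q
  simp only [endpoint] at hs ⊢
  have hnil : ¬ q.Nil := fun hn ↦ by
    have := h.1
    simp [SimpleGraph.Walk.length_eq_zero_iff.2 hn] at this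
  have hq' := SimpleGraph.Walk.concat_dropLast (q.adj_penultimate hnil)
  have hs' : q.dropLast.support = p.support := by
    have := congrArg SimpleGraph.Walk.support hq'
    rw [SimpleGraph.Walk.support_concat, hs] at this
    simpa using this
  have hw : q.penultimate = w := by
    rw [← p.getLast_support, ← q.dropLast.getLast_support]
    simp only [hs']
  refine ⟨hw ▸ q.adj_penultimate hnil, ?_⟩
  apply SimpleGraph.Walk.ext_support
  rw [SimpleGraph.Walk.support_concat, hs]

theorem isParent_of_eq_concat {p q : NonBacktrackingWalk G v₀} (ha : G.Adj p.1 q.1)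
    (h : q.2.1 = p.2.1.concat ha) : p.IsParent q := by
  rw [IsParent, h, SimpleGraph.Walk.length_concat]
  exact ⟨rfl, SimpleGraph.Walk.support_prefix_support_concat _ _⟩

theorem IsParent.adj_endpoint {p q : NonBacktrackingWalk G v₀} (h : p.IsParent q) :
    G.Adj p.endpoint q.endpoint :=
  h.exists_eq_concat.1

/-- A non-backtracking walk does not return to the end of its parent. -/
theorem IsParent.endpoint_ne {p q r : NonBacktrackingWalk G v₀} (h : p.IsParent q)
    (h' : q.IsParent r) : p.endpoint ≠ r.endpoint := by
  obtain ⟨ha, hq⟩ := h.exists_eq_concat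
  obtain ⟨hb, hr⟩ := h'.exists_eq_concat
  intro he
  have hc := r.2.2
  rw [hr, SimpleGraph.Walk.darts_concat, hq, SimpleGraph.Walk.darts_concat] at hc
  simp only [List.concat_eq_append, List.append_assoc, List.singleton_append] at hc
  have := (List.isChain_append.1 hc).2.1
  simp only [List.isChain_cons_cons] at this
  apply this.1
  ext
  · rfl
  · exact he.symm

/-- The only forbidden continuation of a walk is the reversal of its last step, and that one leads
back to the end of its parent. -/
theorem exists_isParent (p : NonBacktrackingWalk G v₀) {y : X} (hy : G.Adj p.endpoint y)
    (hp : ∀ r : NonBacktrackingWalk G v₀, r.IsParent p → r.endpoint ≠ y) :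
    ∃ q : NonBacktrackingWalk G v₀, p.IsParent q ∧ q.endpoint = y := by
  obtain ⟨w, p, hc⟩ := p
  simp only [endpoint] at hy
  refine ⟨⟨y, p.concat hy, ?_⟩, isParent_of_eq_concat hy rfl, rfl⟩
  rw [SimpleGraph.Walk.darts_concat, List.concat_eq_append, List.isChain_append]
  refine ⟨hc, by simp, fun a ha b hb he ↦ ?_⟩
  have hb' : b = ⟨(w, y), hy⟩ := by simpa using hb.symm
  have hnil : ¬ p.Nil := fun hn ↦ by
    simp [SimpleGraph.Walk.darts_eq_nil.2 hn] at ha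
  have hq' := SimpleGraph.Walk.concat_dropLast (p.adj_penultimate hnil)
  have hd := congrArg SimpleGraph.Walk.darts hq'
  rw [SimpleGraph.Walk.darts_concat, List.concat_eq_append] at hd
  have hc' := hc
  rw [← hd] at hc' ha
  refine hp ⟨p.penultimate, p.dropLast, (List.isChain_append.1 hc').1⟩
    (isParent_of_eq_concat (p.adj_penultimate hnil) hq'.symm) ?_
  have ha' : a = ⟨(p.penultimate, w), p.adj_penultimate hnil⟩ := by simpa using ha.symm
  rw [hb', ha'] at he
  have := congrArg (fun d ↦ d.snd) he
  exact this.symm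

/-- The universal cover covers. -/
theorem isCovering_endpoint (G : SimpleGraph X) (v₀ : X) :
    (G.universalCover v₀).IsCovering G endpoint where
  map_adj p q h := by
    rcases h with h | h
    · exact h.adj_endpoint
    · exact h.adj_endpoint.symm
  inj p q r h h' he := by
    -- Children are determined by their endpoints and the parent is unique. A parent and a child
    -- have different endpoints because the walk does not backtrack.
    rcases h with h | h <;> rcases h' with h' | h'
    · exact h.right_unique h' he
    · exact absurd he.symm (h'.endpoint_ne h)
    · exact absurd he (h.endpoint_ne h')
    · exact h.left_unique h'
  surj p y h := by
    by_cases hp : ∀ r : NonBacktrackingWalk G v₀, r.IsParent p → r.endpoint ≠ y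
    · obtain ⟨q, hq, hq'⟩ := p.exists_isParent h hp
      exact ⟨q, .inl hq, hq'⟩
    · push Not at hp
      obtain ⟨r, hr, hr'⟩ := hp
      exact ⟨r, .inr hr, hr'⟩

/-- The universal cover of the base of a covering maps to the total space. -/
theorem exists_isImmersion_universalCover {φ : Y → X} (hφ : G'.IsCovering G φ) (y : Y)
    (hy : φ y = v₀) : ∃ ψ : NonBacktrackingWalk G v₀ → Y, (G.universalCover v₀).IsImmersion G' ψ ∧
      (∀ p, φ (ψ p) = p.endpoint) ∧
      ∀ p, ∃ q : G'.Walk y (ψ p), q.length = p.2.1.length := by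
  have key : ∀ p q : NonBacktrackingWalk G v₀, p.IsParent q →
      G'.Adj (hφ.liftEnd p.2.1 y hy) (hφ.liftEnd q.2.1 y hy) := by
    intro p q h
    obtain ⟨ha, hq⟩ := h.exists_eq_concat
    rw [hq]
    exact hφ.adj_liftEnd_concat _ _ _ _
  refine ⟨fun p ↦ hφ.liftEnd p.2.1 y hy, ⟨?_, ?_⟩, fun p ↦ hφ.map_liftEnd _ _ _,
    fun p ↦ hφ.exists_walk_liftEnd _ _ _⟩
  · rintro p q (h | h)
    · exact key _ _ h
    · exact (key _ _ h).symm
  · intro p q r h h' he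
    -- Following the lift by `φ` gives the endpoint map, so local injectivity is inherited from that
    -- map.
    refine (isCovering_endpoint G v₀).inj h h' ?_
    have := congrArg φ he
    simp only [hφ.map_liftEnd] at this
    exact this

end NonBacktrackingWalk

/-! ### Coverings of hypergraphs -/

namespace MultiHypergraph

variable {V E W F : Type*}

theorem isLeft_ne_of_adj (H : MultiHypergraph V E) {a b : V ⊕ E} (h : H.incidenceGraph.Adj a b) :
    a.isLeft ≠ b.isLeft := by
  rcases a with a | a <;> rcases b with b | b
  · exact h.elim
  · simp
  · simp
  · exact h.elim

/-- A hypergraph isomorphic to the universal cover of `H` covers `H`. -/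
theorem exists_isCovering {H : MultiHypergraph V E} {v₀ : V} {T : MultiHypergraph W F}
    (φ : (H.universalCover v₀).Iso T) : ∃ π : W ⊕ F → V ⊕ E,
      T.incidenceGraph.IsCovering H.incidenceGraph π ∧ (∀ x, (π x).isLeft = x.isLeft) ∧
      ∃ x, π x = .inl v₀ := by
  set U := H.incidenceGraph.universalCover (.inl v₀)
  have hU := NonBacktrackingWalk.isCovering_endpoint H.incidenceGraph (.inl v₀)
  let e : (W ⊕ F) ≃ NonBacktrackingWalk H.incidenceGraph (.inl v₀) :=
    (Equiv.sumCongr φ.onVerts.symm φ.onEdges.symm).trans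
      ((Equiv.sumCongr (Equiv.refl _) (Equiv.subtypeEquivRight (by simp))).trans
        (Equiv.sumCompl fun p : NonBacktrackingWalk H.incidenceGraph (.inl v₀) ↦ p.endpoint.isLeft = true))
  have he : ∀ x, (e x).endpoint.isLeft = x.isLeft := by
    rintro (w | f)
    · exact (φ.onVerts.symm w).2
    · have := (φ.onEdges.symm f).2
      change (φ.onEdges.symm f).1.endpoint.isLeft = false
      simpa using this
  have hadj : ∀ w f, U.Adj (e (.inl w)) (e (.inr f)) ↔ w ∈ T.verts f := by
    intro w f
    have := φ.mem_iff (φ.onVerts.symm w) (φ.onEdges.symm f)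
    simp only [Equiv.apply_symm_apply] at this
    exact this.symm
  let j : T.incidenceGraph ≃g U :=
    { toEquiv := e
      map_rel_iff' := by
        intro a b
        rcases a with a | a <;> rcases b with b | b
        · refine iff_of_false (fun h ↦ ?_) (fun h ↦ h)
          exact H.isLeft_ne_of_adj (hU.map_adj h) (by rw [he, he]; rfl)
        · exact hadj a b
        · rw [U.adj_comm]
          exact hadj b a
        · refine iff_of_false (fun h ↦ ?_) (fun h ↦ h)
          exact H.isLeft_ne_of_adj (hU.map_adj h) (by rw [he, he]; rfl) }
  refine ⟨_, hU.comp_iso j, he, j.symm ⟨_, .nil, by simp⟩, ?_⟩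
  simp [NonBacktrackingWalk.endpoint]

theorem IsConnected.reachable {H : MultiHypergraph V E} (h : H.IsConnected) (u v : V) :
    H.incidenceGraph.Reachable (.inl u) (.inl v) := by
  induction h u v with
  | refl => rfl
  | tail _ hbc ih =>
    obtain ⟨_, e, hb, hc⟩ := hbc
    refine ih.trans (.trans (v := .inr e) ?_ ?_)
    · exact SimpleGraph.Adj.reachable hb
    · exact SimpleGraph.Adj.reachable hc

end MultiHypergraph

/-! ### Lower bounds for the second eigenvalue -/

/-- A lower bound for the second largest eigenvalue from a two-dimensional space of test
vectors. -/
theorem Matrix.IsHermitian.le_eigenvalues₀_one {n : Type*} [Fintype n] [DecidableEq n]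
    {A : Matrix n n ℝ} (hA : A.IsHermitian) (hn : 2 ≤ Fintype.card n) {m : ℝ} (g₁ g₂ : n → ℝ)
    (hind : ∀ c₁ c₂ : ℝ, c₁ • g₁ + c₂ • g₂ = 0 → c₁ = 0 ∧ c₂ = 0)
    (h : ∀ c₁ c₂ : ℝ, m * ((c₁ • g₁ + c₂ • g₂) ⬝ᵥ (c₁ • g₁ + c₂ • g₂)) ≤
      (c₁ • g₁ + c₂ • g₂) ⬝ᵥ A.mulVec (c₁ • g₁ + c₂ • g₂)) :
    m ≤ hA.eigenvalues₀ ⟨1, hn⟩ := by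
  set σ : Fin (Fintype.card n) ≃ n := Fintype.equivOfCardEq (Fintype.card_fin _) with hσ
  set b := hA.eigenvectorBasis with hb
  have hev : ∀ i, hA.eigenvalues (σ i) = hA.eigenvalues₀ i := fun i ↦ by
    simp [Matrix.IsHermitian.eigenvalues, hσ]
  set i₀ : n := σ ⟨0, by omega⟩
  -- A plane contains a nonzero vector orthogonal to the top eigenvector `b i₀`. The Rayleigh
  -- quotient of this vector is at most `λ₂`.
  obtain ⟨c₁, c₂, hc, hc0⟩ : ∃ c₁ c₂ : ℝ,
      (⇑(b i₀) ⬝ᵥ (c₁ • g₁ + c₂ • g₂) = 0) ∧ ¬(c₁ = 0 ∧ c₂ = 0) := by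
    by_cases h1 : ⇑(b i₀) ⬝ᵥ g₁ = 0
    · exact ⟨1, 0, by simp [h1], by simp⟩
    · exact ⟨-(⇑(b i₀) ⬝ᵥ g₂), ⇑(b i₀) ⬝ᵥ g₁,
        by simp [dotProduct_add, dotProduct_smul]; ring, fun h ↦ h1 h.2⟩
  set g := c₁ • g₁ + c₂ • g₂ with hg
  have hg0 : g ≠ 0 := fun h ↦ hc0 (hind _ _ h)
  set x : n → ℝ := fun i ↦ ⇑(b i) ⬝ᵥ g with hx
  have hparseval : ∀ f : n → ℝ, f ⬝ᵥ g = ∑ i, (⇑(b i) ⬝ᵥ f) * x i := by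
    intro f
    have := b.sum_inner_mul_inner (WithLp.toLp 2 f) (WithLp.toLp 2 g)
    simp only [PiLp.inner_apply, RCLike.inner_apply, conj_trivial] at this
    simp only [hx, dotProduct]
    rw [Finset.sum_congr rfl fun i _ ↦ mul_comm (f i) (g i), ← this]
    refine Finset.sum_congr rfl fun i _ ↦ ?_
    congr 1
    exact Finset.sum_congr rfl fun j _ ↦ by ring
  have hAg : g ⬝ᵥ A.mulVec g = ∑ i, hA.eigenvalues i * (x i * x i) := by
    rw [dotProduct_comm, hparseval]
    refine Finset.sum_congr rfl fun i _ ↦ ?_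
    have : ⇑(b i) ⬝ᵥ A.mulVec g = hA.eigenvalues i * x i := by
      rw [Matrix.dotProduct_mulVec, ← Matrix.mulVec_transpose]
      have hT : A.transpose = A := by
        have := hA.eq
        rwa [Matrix.conjTranspose_eq_transpose_of_trivial] at this
      rw [hT, hA.mulVec_eigenvectorBasis, smul_dotProduct, smul_eq_mul]
    rw [this]
    ring
  have hle : g ⬝ᵥ A.mulVec g ≤ hA.eigenvalues₀ ⟨1, hn⟩ * (g ⬝ᵥ g) := by
    rw [hAg, hparseval g, Finset.mul_sum]
    refine Finset.sum_le_sum fun i _ ↦ ?_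
    change _ ≤ _ * (x i * x i)
    obtain ⟨k, rfl⟩ := σ.surjective i
    by_cases hk : k = ⟨0, by omega⟩
    · have : x (σ k) = 0 := by rw [hk]; exact hc
      simp [this]
    · rw [hev]
      refine mul_le_mul_of_nonneg_right (hA.eigenvalues₀_antitone ?_) (mul_self_nonneg _)
      rw [Fin.le_def]
      have : (k : ℕ) ≠ 0 := fun h ↦ hk (Fin.ext h)
      simp only
      omega
  have hpos : 0 < g ⬝ᵥ g := by
    have h1 : 0 ≤ g ⬝ᵥ g := Finset.sum_nonneg fun i _ ↦ mul_self_nonneg _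
    exact lt_of_le_of_ne h1 fun h ↦ hg0 (dotProduct_self_eq_zero.1 h.symm)
  exact le_of_mul_le_mul_right ((h c₁ c₂).trans hle) hpos

namespace MultiHypergraph

variable {V E V' E' : Type*}

theorem le_secondEigenvalue_of_combination [Fintype V] (H : MultiHypergraph V E)
    (hn : 2 ≤ Fintype.card V) {m : ℝ} (g₁ g₂ : V → ℝ)
    (hind : ∀ c₁ c₂ : ℝ, (∀ v, c₁ * g₁ v + c₂ * g₂ v = 0) → c₁ = 0 ∧ c₂ = 0)
    (h : ∀ c₁ c₂ : ℝ, m * ∑ v, (c₁ * g₁ v + c₂ * g₂ v) ^ 2 ≤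
      ∑ u, ∑ v, (H.adjCount u v : ℝ) * ((c₁ * g₁ u + c₂ * g₂ u) * (c₁ * g₁ v + c₂ * g₂ v))) :
    m ≤ H.secondEigenvalue hn := by
  classical
  rw [secondEigenvalue]
  convert! Matrix.IsHermitian.le_eigenvalues₀_one H.adjMatrix_isHermitian hn g₁ g₂ ?_ ?_
  · intro c₁ c₂ h
    exact hind c₁ c₂ fun v ↦ by simpa using congrFun h v
  · intro c₁ c₂
    convert h c₁ c₂ using 1
    · simp [dotProduct, sq]
    · simp only [dotProduct, Matrix.mulVec, Finset.mul_sum, adjMatrix, Matrix.of_apply,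
        Pi.add_apply, Pi.smul_apply, smul_eq_mul]
      exact Finset.sum_congr rfl fun u _ ↦ Finset.sum_congr rfl fun v _ ↦ by ring

/-- Two test functions with separated supports bound the second eigenvalue from below. -/
theorem le_secondEigenvalue_of_separated [Fintype V] (H : MultiHypergraph V E)
    (hn : 2 ≤ Fintype.card V) {m : ℝ} (g₁ g₂ : V → ℝ)
    (h₁ : g₁ ≠ 0) (h₂ : g₂ ≠ 0) (hsep : ∀ u v, g₁ u ≠ 0 → g₂ v ≠ 0 → u ≠ v ∧ H.adjCount u v = 0)
    (hg₁ : m * ∑ v, g₁ v ^ 2 ≤ ∑ u, ∑ v, (H.adjCount u v : ℝ) * (g₁ u * g₁ v))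
    (hg₂ : m * ∑ v, g₂ v ^ 2 ≤ ∑ u, ∑ v, (H.adjCount u v : ℝ) * (g₂ u * g₂ v)) :
    m ≤ H.secondEigenvalue hn := by
  have hdisj : ∀ v, g₁ v * g₂ v = 0 := fun v ↦ by
    by_contra hv
    exact (hsep v v (left_ne_zero_of_mul hv) (right_ne_zero_of_mul hv)).1 rfl
  have hcross : ∀ u v, (H.adjCount u v : ℝ) * (g₁ u * g₂ v) = 0 := fun u v ↦ by
    by_contra hv
    have hv' := right_ne_zero_of_mul hv
    exact left_ne_zero_of_mul hv
      (by exact_mod_cast (hsep u v (left_ne_zero_of_mul hv') (right_ne_zero_of_mul hv')).2)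
  have hcross' : ∀ u v, (H.adjCount u v : ℝ) * (g₂ u * g₁ v) = 0 := fun u v ↦ by
    rw [H.adjCount_comm, mul_comm (g₂ u)]
    exact hcross v u
  refine H.le_secondEigenvalue_of_combination hn g₁ g₂ ?_ ?_
  · intro c₁ c₂ hc
    obtain ⟨u, hu⟩ := Function.ne_iff.1 h₁
    obtain ⟨v, hv⟩ := Function.ne_iff.1 h₂
    have hu2 := (mul_eq_zero.1 (hdisj u)).resolve_left hu
    have hv1 := (mul_eq_zero.1 (hdisj v)).resolve_right hv
    have hcu := hc u
    have hcv := hc v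
    simp only [hu2, hv1, mul_zero, add_zero, zero_add, mul_eq_zero] at hcu hcv
    exact ⟨hcu.resolve_right hu, hcv.resolve_right hv⟩
  · intro c₁ c₂
    have e1 : ∑ v, (c₁ * g₁ v + c₂ * g₂ v) ^ 2 =
        c₁ ^ 2 * ∑ v, g₁ v ^ 2 + c₂ ^ 2 * ∑ v, g₂ v ^ 2 := by
      simp only [Finset.mul_sum, ← Finset.sum_add_distrib]
      refine Finset.sum_congr rfl fun v _ ↦ ?_
      linear_combination 2 * c₁ * c₂ * hdisj v
    have e2 : ∑ u, ∑ v, (H.adjCount u v : ℝ) *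
          ((c₁ * g₁ u + c₂ * g₂ u) * (c₁ * g₁ v + c₂ * g₂ v)) =
        c₁ ^ 2 * ∑ u, ∑ v, (H.adjCount u v : ℝ) * (g₁ u * g₁ v) +
        c₂ ^ 2 * ∑ u, ∑ v, (H.adjCount u v : ℝ) * (g₂ u * g₂ v) := by
      simp only [Finset.mul_sum, ← Finset.sum_add_distrib]
      refine Finset.sum_congr rfl fun u _ ↦ Finset.sum_congr rfl fun v _ ↦ ?_
      linear_combination c₁ * c₂ * (hcross u v + hcross' u v)
    rw [e1, e2]
    nlinarith [mul_le_mul_of_nonneg_left hg₁ (sq_nonneg c₁),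
      mul_le_mul_of_nonneg_left hg₂ (sq_nonneg c₂)]

/-- On the functions supported on two vertices the form is `2 a c₁ c₂ ≥ -a (c₁² + c₂²)` with `a ≤
d`. This crude bound serves for small hypergraphs: it keeps the error function finite. -/
theorem IsRegular.neg_le_secondEigenvalue [Fintype V] {H : MultiHypergraph V E} {d : ℕ}
    (h : H.IsRegular d) (hn : 2 ≤ Fintype.card V) : -(d : ℝ) ≤ H.secondEigenvalue hn := by
  classical
  obtain ⟨u, v, huv⟩ := Fintype.exists_pair_of_one_lt_card (α := V) (by omega)
  have hd : (H.adjCount u v : ℝ) ≤ d := by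
    rw [adjCount_of_ne _ huv, ← (h u).2]
    exact_mod_cast Set.ncard_le_ncard (s := {e | u ∈ H.verts e ∧ v ∈ H.verts e})
      (fun e he ↦ he.1) (h u).1
  refine H.le_secondEigenvalue_of_combination hn (Pi.single u 1) (Pi.single v 1) ?_ ?_
  · intro c₁ c₂ hc
    have h1 := hc u
    have h2 := hc v
    simp [huv, huv.symm] at h1 h2
    exact ⟨h1, h2⟩
  · intro c₁ c₂
    set g : V → ℝ := fun w ↦ c₁ * (Pi.single u 1 : V → ℝ) w + c₂ * (Pi.single v 1 : V → ℝ) w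
    have hgu : g u = c₁ := by simp [g, huv]
    have hgv : g v = c₂ := by simp [g, huv.symm]
    have hg0 : ∀ w, w ∉ ({u, v} : Finset V) → g w = 0 := by
      intro w hw
      simp only [Finset.mem_insert, Finset.mem_singleton, not_or] at hw
      simp [g, hw.1, hw.2]
    change _ * ∑ w, g w ^ 2 ≤ ∑ w, ∑ w', (H.adjCount w w' : ℝ) * (g w * g w')
    have e1 : ∑ w, g w ^ 2 = c₁ ^ 2 + c₂ ^ 2 := by
      rw [← Finset.sum_subset (Finset.subset_univ {u, v}) (fun w _ hw ↦ by simp [hg0 w hw]),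
        Finset.sum_pair huv, hgu, hgv]
    have e2 : ∑ w, ∑ w', (H.adjCount w w' : ℝ) * (g w * g w') =
        2 * (H.adjCount u v : ℝ) * (c₁ * c₂) := by
      rw [← Finset.sum_subset (Finset.subset_univ {u, v}) (fun w _ hw ↦ by simp [hg0 w hw]),
        Finset.sum_pair huv,
        ← Finset.sum_subset (Finset.subset_univ {u, v}) (fun w _ hw ↦ by simp [hg0 w hw]),
        ← Finset.sum_subset (Finset.subset_univ {u, v}) (fun w _ hw ↦ by simp [hg0 w hw]),
        Finset.sum_pair huv, Finset.sum_pair huv, hgu, hgv, H.adjCount_self, H.adjCount_self,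
        H.adjCount_comm v u]
      push_cast
      ring
    rw [e1, e2]
    have h0 : (0 : ℝ) ≤ H.adjCount u v := by positivity
    nlinarith [mul_nonneg h0 (sq_nonneg (c₁ + c₂)),
      mul_nonneg (sub_nonneg.2 hd) (add_nonneg (sq_nonneg c₁) (sq_nonneg c₂))]

end MultiHypergraph

/-- The Schur test: Cauchy–Schwarz with weights `A i j`, then the row and column bounds. -/
theorem Finset.sum_sum_mul_le_sqrt_mul_sqrt {ι κ : Type*} (s : Finset ι) (t : Finset κ)
    (A : ι → κ → ℝ) (hA : ∀ i j, 0 ≤ A i j) {c : ℝ} (hc : 0 ≤ c)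
    (hrow : ∀ i ∈ s, ∑ j ∈ t, A i j ≤ c) (hcol : ∀ j ∈ t, ∑ i ∈ s, A i j ≤ c)
    (f : ι → ℝ) (g : κ → ℝ) :
    ∑ i ∈ s, ∑ j ∈ t, A i j * (f i * g j) ≤
      c * (√(∑ i ∈ s, f i ^ 2) * √(∑ j ∈ t, g j ^ 2)) := by
  have h1 : (∑ i ∈ s, ∑ j ∈ t, A i j * (f i * g j)) ^ 2 ≤
      (∑ i ∈ s, ∑ j ∈ t, A i j * f i ^ 2) * ∑ i ∈ s, ∑ j ∈ t, A i j * g j ^ 2 := by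
    simp only [← Finset.sum_product']
    refine Finset.sum_sq_le_sum_mul_sum_of_sq_le_mul _ (fun x _ ↦ ?_) (fun x _ ↦ ?_)
      (fun x _ ↦ le_of_eq (by ring))
    · exact mul_nonneg (hA _ _) (sq_nonneg _)
    · exact mul_nonneg (hA _ _) (sq_nonneg _)
  have h2 : ∑ i ∈ s, ∑ j ∈ t, A i j * f i ^ 2 ≤ c * ∑ i ∈ s, f i ^ 2 := by
    rw [Finset.mul_sum]
    refine Finset.sum_le_sum fun i hi ↦ ?_
    rw [← Finset.sum_mul]
    exact mul_le_mul_of_nonneg_right (hrow i hi) (sq_nonneg _)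
  have h3 : ∑ i ∈ s, ∑ j ∈ t, A i j * g j ^ 2 ≤ c * ∑ j ∈ t, g j ^ 2 := by
    rw [Finset.sum_comm, Finset.mul_sum]
    refine Finset.sum_le_sum fun j hj ↦ ?_
    rw [← Finset.sum_mul]
    exact mul_le_mul_of_nonneg_right (hcol j hj) (sq_nonneg _)
  refine le_of_sq_le_sq ?_ (by positivity)
  rw [mul_pow, mul_pow, Real.sq_sqrt (by positivity), Real.sq_sqrt (by positivity)]
  refine h1.trans ((mul_le_mul h2 h3 ?_ (by positivity)).trans (le_of_eq (by ring)))
  exact Finset.sum_nonneg fun i _ ↦ Finset.sum_nonneg fun j _ ↦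
    mul_nonneg (hA _ _) (sq_nonneg _)

/-! ### Pushing functions forward along immersions -/

namespace MultiHypergraph

variable {V E V' E' : Type*}

/-- A pair of maps preserving incidence and injective on each edge and on the edges at each
vertex. -/
structure IsImmersion (H' : MultiHypergraph V' E') (H : MultiHypergraph V E) (a : V' → V)
    (b : E' → E) : Prop where
  map_mem : ∀ ⦃v e⦄, v ∈ H'.verts e → a v ∈ H.verts (b e)
  injOn_verts : ∀ e, Set.InjOn a (H'.verts e)
  injOn_edgesAt : ∀ v, Set.InjOn b (H'.edgesAt v)

namespace IsImmersion

variable {H' : MultiHypergraph V' E'} {H : MultiHypergraph V E} {a : V' → V} {b : E' → E}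

-- The map `b` sends the pairs (`t`, edge through `s` and `t`) with `a t = y` injectively to edges
-- through `a s` and `y`: the image determines the edge at `s`, and the edge contains at most one
-- `t` over `y`. If `a s = y`, no edge contains both `s` and another `t` over `y`, so the sum
-- vanishes like the diagonal entry.
open Classical in
theorem sum_adjCount_le [Finite E] (h : H'.IsImmersion H a b) (S : Finset V') (s : V') (y : V) :
    ∑ t ∈ S with a t = y, H'.adjCount s t ≤ H.adjCount (a s) y := by
  by_cases hy : a s = y
  · refine le_trans (le_of_eq ?_) (Nat.zero_le _)
    refine Finset.sum_eq_zero fun t ht ↦ ?_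
    have hty := (Finset.mem_filter.1 ht).2
    by_cases hst : s = t
    · rw [hst, adjCount_self]
    · rw [adjCount_of_ne _ hst]
      convert Set.ncard_empty E'
      ext e
      simp only [Set.mem_ofPred_eq, Set.mem_empty_iff_false, iff_false]
      exact fun he ↦ hst (h.injOn_verts e he.1 he.2 (hy.trans hty.symm))
  · have hP : ∀ t, ({e | s ∈ H'.verts e ∧ t ∈ H'.verts e} : Set E').ncard =
        (Set.toFinite (b '' {e | s ∈ H'.verts e ∧ t ∈ H'.verts e})).toFinset.card := by
      intro t
      rw [← Set.ncard_eq_toFinset_card, Set.InjOn.ncard_image]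
      exact (h.injOn_edgesAt s).mono fun e he ↦ he.1
    have hsum : ∑ t ∈ S with a t = y, H'.adjCount s t = ∑ t ∈ S with a t = y,
        (Set.toFinite (b '' {e | s ∈ H'.verts e ∧ t ∈ H'.verts e})).toFinset.card := by
      refine Finset.sum_congr rfl fun t ht ↦ ?_
      have hty := (Finset.mem_filter.1 ht).2
      rw [adjCount_of_ne _ (by rintro rfl; exact hy hty), hP]
    rw [hsum, adjCount_of_ne _ hy, ← Finset.card_biUnion,
      Set.ncard_eq_toFinset_card _ (Set.toFinite _)]
    · refine Finset.card_le_card fun e he ↦ ?_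
      simp only [Finset.mem_biUnion, Finset.mem_filter, Set.Finite.mem_toFinset, Set.mem_image,
        Set.mem_ofPred_eq] at he ⊢
      obtain ⟨t, ⟨-, rfl⟩, e', ⟨h1, h2⟩, rfl⟩ := he
      exact ⟨h.map_mem h1, h.map_mem h2⟩
    · intro t ht t' ht' htt'
      rw [Function.onFun, Finset.disjoint_left]
      intro e he he'
      simp only [Set.Finite.mem_toFinset, Set.mem_image, Set.mem_ofPred_eq] at he he'
      obtain ⟨e₁, ⟨h1, h2⟩, rfl⟩ := he
      obtain ⟨e₂, ⟨h3, h4⟩, h5⟩ := he'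
      obtain rfl := h.injOn_edgesAt s h3 h1 h5
      exact htt' (h.injOn_verts _ h2 h4
        ((Finset.mem_filter.1 ht).2.trans (Finset.mem_filter.1 ht').2.symm))

/-- Pushing a function forward along an immersion, taking `ℓ²` norms on fibres, does not decrease
the Rayleigh quotient. -/
theorem exists_pushforward [Fintype V] [Finite E] (h : H'.IsImmersion H a b) (S : Finset V')
    (f : V' → ℝ) : ∃ g : V → ℝ, ∑ v, g v ^ 2 = ∑ s ∈ S, f s ^ 2 ∧
      ∑ s ∈ S, ∑ t ∈ S, (H'.adjCount s t : ℝ) * (f s * f t) ≤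
        ∑ u, ∑ v, (H.adjCount u v : ℝ) * (g u * g v) ∧
      ∀ v, g v ≠ 0 → ∃ s ∈ S, a s = v := by
  classical
  refine ⟨fun x ↦ √(∑ s ∈ S with a s = x, f s ^ 2), ?_, ?_, ?_⟩
  · rw [← Finset.sum_fiberwise S a (fun s ↦ f s ^ 2)]
    exact Finset.sum_congr rfl fun x _ ↦ Real.sq_sqrt (by positivity)
  · have h1 : ∑ s ∈ S, ∑ t ∈ S, (H'.adjCount s t : ℝ) * (f s * f t) =
        ∑ x, ∑ y, ∑ s ∈ S with a s = x, ∑ t ∈ S with a t = y,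
          (H'.adjCount s t : ℝ) * (f s * f t) := by
      rw [← Finset.sum_fiberwise S a
        (fun s ↦ ∑ t ∈ S, (H'.adjCount s t : ℝ) * (f s * f t))]
      refine Finset.sum_congr rfl fun x _ ↦ ?_
      refine Eq.trans ?_ Finset.sum_comm
      refine Finset.sum_congr rfl fun s _ ↦ ?_
      exact (Finset.sum_fiberwise S a fun t ↦ (H'.adjCount s t : ℝ) * (f s * f t)).symm
    rw [h1]
    refine Finset.sum_le_sum fun x _ ↦ Finset.sum_le_sum fun y _ ↦ ?_
    -- The block between the fibres over `x` and `y` has row and column sums at most `H.adjCount x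
    -- y`.
    refine Finset.sum_sum_mul_le_sqrt_mul_sqrt _ _ (fun s t ↦ (H'.adjCount s t : ℝ))
      (fun _ _ ↦ by positivity) (by positivity) (fun s hs ↦ ?_) (fun t ht ↦ ?_) f f
    · rw [← (Finset.mem_filter.1 hs).2]
      exact_mod_cast h.sum_adjCount_le S s y
    · rw [← (Finset.mem_filter.1 ht).2, H.adjCount_comm]
      simp only [H'.adjCount_comm _ t]
      exact_mod_cast h.sum_adjCount_le S t x
  · intro v hv
    by_contra! hS
    refine hv ?_
    simp only
    rw [Finset.filter_eq_empty_iff.2 (fun s hs ↦ hS s hs), Finset.sum_empty, Real.sqrt_zero]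

end IsImmersion

/-- An immersion of incidence graphs that preserves the two sides gives an immersion of
hypergraphs. -/
theorem isImmersion_of_universalCover {V₀ E₀ : Type*} {H₀ : MultiHypergraph V₀ E₀} {h₀ : V₀}
    {H : MultiHypergraph V E} {χ : NonBacktrackingWalk H₀.incidenceGraph (.inl h₀) → V ⊕ E}
    (hχ : (H₀.incidenceGraph.universalCover (.inl h₀)).IsImmersion H.incidenceGraph χ)
    (hl : ∀ p, (χ p).isLeft = p.endpoint.isLeft) :
    ∃ (a : _ → V) (b : _ → E), (H₀.universalCover h₀).IsImmersion H a b ∧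
      ∀ p, χ p.1 = .inl (a p) := by
  have hr : ∀ p, (χ p).isRight = p.endpoint.isRight := fun p ↦ by
    have := hl p
    revert this
    cases χ p <;> cases p.endpoint <;> simp
  set a : {p : NonBacktrackingWalk H₀.incidenceGraph (.inl h₀) // p.endpoint.isLeft = true} → V :=
    fun p ↦ (χ p.1).getLeft ((hl p.1).trans p.2)
  set b : {p : NonBacktrackingWalk H₀.incidenceGraph (.inl h₀) // p.endpoint.isRight = true} → E :=
    fun p ↦ (χ p.1).getRight ((hr p.1).trans p.2)
  have ha : ∀ p, χ p.1 = .inl (a p) := fun p ↦ by simp [a]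
  have hb : ∀ p, χ p.1 = .inr (b p) := fun p ↦ by simp [b]
  refine ⟨a, b, ⟨fun v e h ↦ ?_, fun e v h w h' he ↦ ?_, fun v e h e' h' he ↦ ?_⟩, ha⟩
  · have := hχ.map_adj h
    rw [ha, hb] at this
    exact this
  · exact Subtype.ext (hχ.inj (SimpleGraph.Adj.symm h) (SimpleGraph.Adj.symm h')
      (by rw [ha, ha, he]))
  · exact Subtype.ext (hχ.inj h h' (by rw [hb, hb, he]))

end MultiHypergraph

/-! ### Transport to distant places and the conclusion -/

theorem SimpleGraph.ncard_ball_le {X : Type*} [Finite X] (G : SimpleGraph X) {K : ℕ}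
    (hK : ∀ x, {y | G.Adj x y}.ncard ≤ K) (r : ℕ) : ∀ x,
    {y | ∃ p : G.Walk x y, p.length ≤ r}.ncard ≤ (K + 1) ^ r := by
  classical
  cases nonempty_fintype X
  induction r with
  | zero =>
    intro x
    refine (Set.ncard_le_ncard (t := {x}) ?_ (Set.toFinite _)).trans (by simp)
    rintro y ⟨p, hp⟩
    exact (p.eq_of_length_eq_zero (by omega)).symm
  | succ r ih =>
    intro x
    set N : Finset X := (Set.toFinite {y | G.Adj x y}).toFinset with hN
    have hNK : N.card ≤ K := by
      rw [hN, ← Set.ncard_eq_toFinset_card]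
      exact hK x
    set B : X → Finset X := fun y ↦
      (Set.toFinite {z | ∃ p : G.Walk y z, p.length ≤ r}).toFinset with hB
    have hBK : ∀ y, (B y).card ≤ (K + 1) ^ r := fun y ↦ by
      rw [hB, ← Set.ncard_eq_toFinset_card]
      exact ih y
    have hsub : {y | ∃ p : G.Walk x y, p.length ≤ r + 1} ⊆ ({x} ∪ N.biUnion B : Finset X) := by
      rintro y ⟨p, hp⟩
      cases p with
      | nil => simp
      | cons h p =>
        simp only [SimpleGraph.Walk.length_cons, add_le_add_iff_right] at hp
        simp only [Finset.coe_union, Finset.coe_singleton, Set.singleton_union, Set.mem_insert_iff,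
          Finset.mem_coe, Finset.mem_biUnion]
        exact .inr ⟨_, by simpa [hN] using h, by simpa [hB] using ⟨p, hp⟩⟩
    calc _ ≤ ({x} ∪ N.biUnion B : Finset X).card := by
          rw [← Set.ncard_coe_finset]
          exact Set.ncard_le_ncard hsub (Finset.finite_toSet _)
      _ ≤ 1 + N.card * (K + 1) ^ r :=
          (Finset.card_union_le _ _).trans
            (Nat.add_le_add (by simp) (Finset.card_biUnion_le_card_mul _ _ _ fun y _ ↦ hBK y))
      _ ≤ (K + 1) ^ r + K * (K + 1) ^ r :=
          Nat.add_le_add (Nat.one_le_pow _ _ (by omega)) (Nat.mul_le_mul_right _ hNK)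
      _ = (K + 1) ^ (r + 1) := by ring

namespace MultiHypergraph

variable {V E : Type*}

/-- A function with large Rayleigh quotient on the universal cover of `H₀` can be transported into
a bounded neighbourhood of any vertex of a hypergraph with the same universal cover. -/
theorem exists_transport {V₀ E₀ W F : Type*} [Finite V₀] {T : MultiHypergraph W F}
    {H₀ : MultiHypergraph V₀ E₀} {h₀ : V₀} (hH₀ : H₀.IsConnected)
    (φ₀ : (H₀.universalCover h₀).Iso T) (S : Finset _) (f : _ → ℝ) :
    ∃ R : ℕ, ∀ {V : Type u} {E : Type v} [Fintype V] [Finite E] (H : MultiHypergraph V E) (v₀ : V),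
      H.IsConnected → (H.universalCover v₀).Iso T → ∀ v : V, ∃ g : V → ℝ,
      ∑ v, g v ^ 2 = ∑ s ∈ S, f s ^ 2 ∧
      ∑ s ∈ S, ∑ t ∈ S, ((H₀.universalCover h₀).adjCount s t : ℝ) * (f s * f t) ≤
        ∑ u, ∑ v, (H.adjCount u v : ℝ) * (g u * g v) ∧
      ∀ x, g x ≠ 0 → ∃ p : H.incidenceGraph.Walk (.inl v) (.inl x), p.length ≤ R := by
  have hD : ∃ D : ℕ, ∀ h, ∃ p : H₀.incidenceGraph.Walk (.inl h) (.inl h₀), p.length ≤ D := by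
    obtain ⟨D, hD⟩ := (Set.finite_range fun h ↦ (hH₀.reachable h h₀).some.length).bddAbove
    exact ⟨D, fun h ↦ ⟨_, hD ⟨h, rfl⟩⟩⟩
  obtain ⟨D, hD⟩ := hD
  -- `D` bounds the way to a lift of `h₀`, and the second term bounds the way from there to the copy
  -- of a point of `S`. Neither depends on `H`.
  refine ⟨D + S.sup fun s ↦ s.1.2.1.length, fun {V E} _ _ H v₀ hH φ v ↦ ?_⟩
  obtain ⟨π₀, hπ₀, hl₀, -⟩ := exists_isCovering φ₀
  obtain ⟨π, hπ, hl, x₀, hx₀⟩ := exists_isCovering φ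
  -- `T` covers both `H` and `H₀`: lift `v` to `t`, then move inside `T` to a nearby `t'` over `h₀`.
  -- The cover of `H₀` immerses into `T` with its root at `t'`, and from there into `H`.
  obtain ⟨t, ht, -⟩ := hπ.exists_lift (hH.reachable v₀ v).some x₀ hx₀
  obtain ⟨h, hh⟩ : ∃ h, π₀ t = .inl h := by
    rw [← Sum.isLeft_iff, hl₀, ← hl, ht]
    rfl
  obtain ⟨p, hp⟩ := hD h
  obtain ⟨t', ht', q, hq⟩ := hπ₀.exists_lift p t hh
  obtain ⟨ψ, hψ, hψe, hψw⟩ := NonBacktrackingWalk.exists_isImmersion_universalCover hπ₀ t' ht'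
  obtain ⟨a, b, hab, ha⟩ := isImmersion_of_universalCover (hπ.toIsImmersion.comp hψ)
    (fun p ↦ by rw [Function.comp_apply, hl, ← hl₀, hψe])
  obtain ⟨g, hg1, hg2, hg3⟩ := hab.exists_pushforward S f
  refine ⟨g, hg1, hg2, fun x hx ↦ ?_⟩
  obtain ⟨s, hs, rfl⟩ := hg3 x hx
  obtain ⟨q', hq'⟩ := hψw s.1
  obtain ⟨w, hw⟩ := hπ.exists_walk_map (q.append q')
  rw [← ha, ← ht]
  refine ⟨w, ?_⟩
  have := Finset.le_sup (f := fun s ↦ s.1.2.1.length) hs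
  rw [hw, SimpleGraph.Walk.length_append]
  omega

/-- Hypergraphs whose universal cover is that of `H₀` have the local degrees of `H₀`. -/
theorem ncard_neighbors_le {V₀ E₀ W F : Type*} [Finite V₀] [Finite E₀] {T : MultiHypergraph W F}
    {H₀ : MultiHypergraph V₀ E₀} {h₀ : V₀} (φ₀ : (H₀.universalCover h₀).Iso T)
    {H : MultiHypergraph V E} {v₀ : V} (hH : H.IsConnected) (φ : (H.universalCover v₀).Iso T)
    (y : V ⊕ E) :
    {z | H.incidenceGraph.Adj y z}.ncard ≤ Nat.card (V₀ ⊕ E₀) := by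
  obtain ⟨π₀, hπ₀, -, -⟩ := exists_isCovering φ₀
  obtain ⟨π, hπ, -, x₀, hx₀⟩ := exists_isCovering φ
  -- An empty edge cannot be reached from `v₀`, so it is treated apart.
  rcases Set.eq_empty_or_nonempty {z | H.incidenceGraph.Adj y z} with he | ⟨z, hz⟩
  · simp [he]
  have hy : H.incidenceGraph.Reachable (.inl v₀) y := by
    rcases y with v | e
    · exact hH.reachable v₀ v
    · rcases z with v | e'
      · exact (hH.reachable v₀ v).trans (SimpleGraph.Adj.reachable hz.symm)
      · exact hz.elim
  obtain ⟨t, rfl, -⟩ := hπ.exists_lift hy.some x₀ hx₀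
  have hfin : {s | T.incidenceGraph.Adj t s}.Finite :=
    Set.Finite.of_injOn (f := π₀) (t := Set.univ) (Set.mapsTo_univ _ _)
      (fun s hs s' hs' h ↦ hπ₀.inj hs hs' h) Set.finite_univ
  calc {z | H.incidenceGraph.Adj (π t) z}.ncard
      ≤ (π '' {s | T.incidenceGraph.Adj t s}).ncard :=
        Set.ncard_le_ncard (fun z hz ↦ hπ.surj hz) (hfin.image _)
    _ ≤ {s | T.incidenceGraph.Adj t s}.ncard := Set.ncard_image_le hfin
    _ ≤ (Set.univ : Set (V₀ ⊕ E₀)).ncard := Set.ncard_le_ncard_of_injOn π₀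
        (fun _ _ ↦ Set.mem_univ _) (fun s hs s' hs' h ↦ hπ₀.inj hs hs' h) Set.finite_univ
    _ = _ := Set.ncard_univ _

/-- Large hypergraphs with a given universal cover have large second eigenvalue. -/
theorem exists_forall_le_secondEigenvalue {V₀ E₀ W F : Type*} [Finite V₀] [Finite E₀]
    {T : MultiHypergraph W F} {H₀ : MultiHypergraph V₀ E₀} {h₀ : V₀} (hH₀ : H₀.IsConnected)
    (φ₀ : (H₀.universalCover h₀).Iso T) {m : ℝ} (hm : ¬ (H₀.universalCover h₀).RayleighLE m) :
    ∃ N : ℕ, ∀ {V : Type u} {E : Type v} [Fintype V] [Finite E] (H : MultiHypergraph V E) (v₀ : V),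
      H.IsConnected → (H.universalCover v₀).Iso T → ∀ hn : 2 ≤ Fintype.card V,
      N ≤ Fintype.card V → m ≤ H.secondEigenvalue hn := by
  unfold RayleighLE at hm
  push Not at hm
  obtain ⟨S, f, -, hf⟩ := hm
  obtain ⟨R, hR⟩ := exists_transport.{u, v} hH₀ φ₀ S f
  -- One more than the size bound for a ball of radius `2R + 2`, so some vertex lies outside. Each
  -- support has radius `R`, and a common edge would add two steps in the incidence graph.
  refine ⟨(Nat.card (V₀ ⊕ E₀) + 1) ^ (R + (2 + R)) + 1, fun {V E} _ _ H v₀ hH φ hn hN ↦ ?_⟩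
  have hball := H.incidenceGraph.ncard_ball_le (ncard_neighbors_le φ₀ hH φ) (R + (2 + R))
    (.inl v₀)
  obtain ⟨v, hv⟩ : ∃ v : V, ∀ p : H.incidenceGraph.Walk (.inl v₀) (.inl v),
      R + (2 + R) < p.length := by
    by_contra! h
    have h1 := Set.ncard_le_ncard_of_injOn (s := (Set.univ : Set V))
      (t := {y | ∃ p : H.incidenceGraph.Walk (.inl v₀) y, p.length ≤ R + (2 + R)}) Sum.inl
      (fun v _ ↦ h v) Sum.inl_injective.injOn (Set.toFinite _)
    rw [Set.ncard_univ, Nat.card_eq_fintype_card] at h1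
    have := h1.trans hball
    omega
  obtain ⟨g₁, h1, h1', h1s⟩ := hR H v₀ hH φ v₀
  obtain ⟨g₂, h2, h2', h2s⟩ := hR H v₀ hH φ v
  -- The inequality `hf` is strict, so `f` does not vanish on `S`.
  have hne : ∀ g : V → ℝ, ∑ v, g v ^ 2 = ∑ s ∈ S, f s ^ 2 → g ≠ 0 := by
    rintro g hg rfl
    have h0 : ∑ s ∈ S, f s ^ 2 = 0 := by simp [← hg]
    have hf0 := (Finset.sum_eq_zero_iff_of_nonneg fun s _ ↦ sq_nonneg (f s)).1 h0
    rw [h0, mul_zero] at hf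
    refine hf.ne' (Finset.sum_eq_zero fun s hs ↦ Finset.sum_eq_zero fun t _ ↦ ?_)
    rw [pow_eq_zero_iff two_ne_zero |>.1 (hf0 s hs)]
    simp
  refine H.le_secondEigenvalue_of_separated hn g₁ g₂ (hne _ h1) (hne _ h2) ?_
    (by rw [h1]; exact hf.le.trans h1') (by rw [h2]; exact hf.le.trans h2')
  intro x y hx hy
  obtain ⟨p, hp⟩ := h1s x hx
  obtain ⟨q, hq⟩ := h2s y hy
  refine ⟨?_, ?_⟩
  · rintro rfl
    have := hv (p.append q.reverse)
    rw [SimpleGraph.Walk.length_append, SimpleGraph.Walk.length_reverse] at this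
    omega
  · by_contra hxy
    have hne' : x ≠ y := by
      rintro rfl
      exact hxy (H.adjCount_self x)
    rw [adjCount_of_ne _ hne'] at hxy
    obtain ⟨e, hxe, hye⟩ := Set.nonempty_of_ncard_ne_zero hxy
    have h3 : H.incidenceGraph.Adj (.inl x) (.inr e) := hxe
    have h4 : H.incidenceGraph.Adj (.inr e) (.inl y) := hye
    have := hv (p.append (.cons h3 (.cons h4 q.reverse)))
    simp only [SimpleGraph.Walk.length_append, SimpleGraph.Walk.length_reverse,
      SimpleGraph.Walk.length_cons] at this
    omega

end MultiHypergraph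

open MultiHypergraph in
theorem theorem1p2 (d : ℕ) {W : Type w} {F : Type z} (T : MultiHypergraph W F) :
    ∃ err : ℕ → ℝ, Filter.Tendsto err Filter.atTop (nhds 0) ∧
      ∀ (V : Type u) (E : Type v) [Fintype V] [Finite E] (H : MultiHypergraph V E) (v₀ : V),
        H.IsConnected → H.IsRegular d → Nonempty ((H.universalCover v₀).Iso T) →
        ∀ hn : 2 ≤ Fintype.card V,
          (H.universalCover v₀).rho - err (Fintype.card V) ≤ H.secondEigenvalue hn := by
  by_cases hex : ∃ (V : Type u) (E : Type v) (_ : Fintype V) (_ : Finite E)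
      (H : MultiHypergraph V E) (v₀ : V), H.IsConnected ∧ Nonempty ((H.universalCover v₀).Iso T)
  swap
  · refine ⟨fun _ ↦ 0, tendsto_const_nhds, fun V E _ _ H v₀ hH _ hφ _ ↦ ?_⟩
    exact absurd ⟨V, E, ‹_›, ‹_›, H, v₀, hH, hφ⟩ hex
  obtain ⟨V₀, E₀, _, _, H₀, h₀, hH₀, ⟨φ₀⟩⟩ := hex
  have root : ∀ {V : Type u} {E : Type v} (H : MultiHypergraph V E) (v₀ : V),
      Nonempty {p : NonBacktrackingWalk H.incidenceGraph (.inl v₀) // p.endpoint.isLeft = true} :=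
    fun H v₀ ↦ ⟨⟨⟨_, .nil, by simp⟩, rfl⟩⟩
  have _ := root H₀ h₀
  -- The optimal Rayleigh bound depends only on `T`, so it dominates `ρ` for every `H` under
  -- consideration.
  set R : ℝ := sInf {m | (H₀.universalCover h₀).RayleighLE m}
  have hbdd : BddBelow {m | (H₀.universalCover h₀).RayleighLE m} := ⟨0, fun m hm ↦ hm.nonneg⟩
  set P : ℕ → Set ℝ := fun n ↦ {x | ∃ (V : Type u) (E : Type v) (_ : Fintype V) (_ : Finite E)
    (H : MultiHypergraph V E) (v₀ : V) (hn : 2 ≤ Fintype.card V), H.IsConnected ∧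
      H.IsRegular d ∧ Nonempty ((H.universalCover v₀).Iso T) ∧ Fintype.card V = n ∧
      x = R - H.secondEigenvalue hn}
  have hPd : ∀ n, ∀ x ∈ P n, x ≤ R + d := by
    rintro n x ⟨V, E, _, _, H, v₀, hn, -, hd, -, -, rfl⟩
    linarith [hd.neg_le_secondEigenvalue hn]
  have hPbdd : ∀ n, BddAbove (insert 0 (P n)) := fun n ↦
    BddAbove.insert 0 ⟨_, fun x hx ↦ hPd n x hx⟩
  -- The error is the worst deficit `R - λ₂` over all admissible `H` with `n` vertices. Inserting
  -- `0` makes it nonnegative, and `λ₂ ≥ -d` makes the supremum finite.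
  refine ⟨fun n ↦ sSup (insert 0 (P n)), ?_, ?_⟩
  · rw [Metric.tendsto_atTop]
    intro ε hε
    have hnot : ¬ (H₀.universalCover h₀).RayleighLE (R - ε / 2) := fun h ↦ by
      have : R ≤ R - ε / 2 := csInf_le hbdd h
      linarith
    obtain ⟨N, hN⟩ := exists_forall_le_secondEigenvalue.{u, v} hH₀ φ₀ hnot
    refine ⟨N, fun n hn ↦ ?_⟩
    have h0 : 0 ≤ sSup (insert 0 (P n)) := le_csSup (hPbdd n) (Set.mem_insert _ _)
    have h1 : sSup (insert 0 (P n)) ≤ ε / 2 := by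
      refine csSup_le (Set.insert_nonempty _ _) ?_
      rintro x (rfl | ⟨V, E, _, _, H, v₀, h2, hH, -, ⟨φ⟩, rfl, rfl⟩)
      · positivity
      · linarith [hN H v₀ hH φ h2 hn]
    rw [Real.dist_eq, sub_zero, abs_of_nonneg h0]
    linarith
  · intro V E _ _ H v₀ hH hd hφ hn
    have _ := root H v₀
    have hrho : (H.universalCover v₀).rho ≤ R :=
      le_csInf (H₀.universalCover h₀).exists_rayleighLE fun m hm ↦
        ((RayleighLE.of_iso hm φ₀).of_iso hφ.some.symm).rho_le
    have := le_csSup (hPbdd (Fintype.card V)) (Set.mem_insert_of_mem _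
      ⟨V, E, ‹_›, ‹_›, H, v₀, hn, hH, hd, hφ, rfl, rfl⟩)
    linarith
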